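/- Let $D,E,M\in\mathbb N$. Consider a discounted Markov decision process with state space $\mathcal S=\{(c,j,d,e): c,j\in\{0,1\},\ 0\le d\le D,\ 0\le e\le E\}$ (channel status, jammer status, number of queued packets, number of stored energy units), with the $M+4$ actions $\mathcal A=\{1,\dots,M+4\}$ (stay idle, transmit, harvest energy, backscatter, or adapt the transmission to one of $M$ rates), and with discount factor $0\le\gamma<1$. Performing action $a$ in state $s$ yields a real immediate reward and a next state $s'$ with an arbitrary joint law depending only on $(s,a)$; the rewards are bounded, and $r(s,a)$ denotes the mean reward. For a policy $\pi:\mathcal S\to\mathcal A$ let $V^\pi(s)=\mathbb E_\pi\big[\sum_{t\ge0}\gamma^t r_t\mid s_0=s\big]$, and put $V^*(s)=\max_\pi V^\pi(s)$ and $Q^*(s,a)=r(s,a)+\gamma\,\mathbb E[V^*(s')\mid s,a]$. Let $(s_t,a_t,r_t)_{t\ge0}$ be a run of this process, where the actions are selected in an arbitrary, possibly randomized and history-dependent way: given the history up to and including $(s_t,a_t)$, the pair $(r_t,s_{t+1})$ has the law prescribed for $(s_t,a_t)$. Let $\tau_0,\tau_1,\dots$ be a deterministic sequence of learning rates and $Q_0:\mathcal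 S\times\mathcal A\to\mathbb R$ an arbitrary initial table. Tabular Q-learning sets $$Q_{t+1}(s_t,a_t)=Q_t(s_t,a_t)+\tau_t\Big[r_t+\gamma\max_{a'\in\mathcal A}Q_t(s_{t+1},a')-Q_t(s_t,a_t)\Big]$$ and leaves all the other entries of the table unchanged. Suppose that, with probability one, every pair $(s,a)\in\mathcal S\times\mathcal A$ is visited infinitely often and, if $t^1<t^2<\cdots$ are the times at which $(s_t,a_t)=(s,a)$, the learning rates used for this pair satisfy $$\tau_{t^i}\in[0,1),\qquad \sum_{i}\tau_{t^i}=\infty,\qquad \sum_{i}\tau_{t^i}^2<\infty .$$ Then, with probability one, $Q_t(s,a)\to Q^*(s,a)$ as $t\to\infty$ for all $(s,a)\in\mathcal S\times\mathcal A$. -/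

import Mathlib

open MeasureTheory ProbabilityTheory Filter Topology

noncomputable section

namespace AntiJamming

/-- States `(c, j, d, e)`: channel status `c ∈ {0,1}`, jammer status `j ∈ {0,1}`, number of queued
packets `d ∈ {0,…,D}`, number of stored energy units `e ∈ {0,…,E}`. -/
abbrev State (D E : ℕ) : Type := Fin 2 × Fin 2 × Fin (D + 1) × Fin (E + 1)

/-- The `M + 4` actions, numbered from `0`: stay idle, transmit, harvest, backscatter, and
`4, …, M + 3`, adapt the rate to `r₁, …, r_M`. -/
abbrev Action (M : ℕ) : Type := Fin (M + 4)

/-- A discounted Markov decision process with random bounded rewards. `law s a` is the joint law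
of the immediate reward and of the next state when action `a` is performed in state `s`. -/
structure MDP (S A : Type) [MeasurableSpace S] where
  law : S → A → Measure (ℝ × S)
  isProb : ∀ s a, IsProbabilityMeasure (law s a)
  bounded : ∃ r : ℝ, ∀ s a, ∀ᵐ x ∂(law s a), |x.1| ≤ r
  γ : ℝ
  γ_nonneg : 0 ≤ γ
  γ_lt_one : γ < 1

section General

variable {S A : Type} [Fintype S] [MeasurableSpace S]

/-- The expected immediate reward of action `a` in state `s`. -/
def MDP.meanReward (P : MDP S A) (s : S) (a : A) : ℝ := ∫ x, x.1 ∂(P.law s a)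

/-- The probability of moving to state `s'` when action `a` is performed in state `s`. -/
def MDP.trans (P : MDP S A) (s : S) (a : A) (s' : S) : ℝ :=
  (P.law s a).real {x | x.2 = s'}

/-- `E_π[r_t | s_0 = s]`: the expected reward at time `t` of the chain started at `s` and
controlled by the policy `π`. -/
def MDP.expReward (P : MDP S A) (π : S → A) : ℕ → S → ℝ
  | 0, s => P.meanReward s (π s)
  | t + 1, s => ∑ s', P.trans s (π s) s' * MDP.expReward P π t s'

/-- `V^π(s) = E_π[∑_t γ^t r_t | s_0 = s]`. -/
def MDP.value (P : MDP S A) (π : S → A) (s : S) : ℝ :=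
  ∑' t : ℕ, P.γ ^ t * P.expReward π t s

/-- The optimal value `V^*(s)`, the maximum of `V^π(s)` over the policies `π : S → A`
(there are finitely many when `A` is finite). -/
def MDP.optValue (P : MDP S A) (s : S) : ℝ := ⨆ π : S → A, P.value π s

/-- The optimal action values `Q^*(s, a) = E[r(s, a)] + γ E[V^*(s')]`. -/
def MDP.optQ (P : MDP S A) (s : S) (a : A) : ℝ :=
  P.meanReward s a + P.γ * ∑ s', P.trans s a s' * P.optValue s'

end General

/-- The table `Q_t` computed by tabular Q-learning with learning rates `τ`, discount factor `γ`
and initial table `Q₀` along the states `s`, actions `a` and rewards `r`. Only the entry of the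
pair `(s t, a t)` is changed in step `t`. -/
def qLearning {S A : Type} [DecidableEq S] [DecidableEq A] [Fintype A] [Nonempty A]
    (γ : ℝ) (τ : ℕ → ℝ) (Q₀ : S → A → ℝ) (s : ℕ → S) (a : ℕ → A) (r : ℕ → ℝ) :
    ℕ → S → A → ℝ
  | 0 => Q₀
  | t + 1 => fun x b =>
      let Q := qLearning γ τ Q₀ s a r t
      if x = s t ∧ b = a t then
        Q x b + τ t * (r t + γ * Finset.univ.sup' Finset.univ_nonempty (Q (s (t + 1))) - Q x b)
      else Q x b

/-- `(s_t, a_t, r_t)` is a run of the decision process `P` on the probability space `(Ω, μ)`, with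
information `ℱ t` available when the consequences of `a_t` are about to be observed: the pair
`(s_t, a_t)` is known at time `t`, the actions being selected in any way, possibly randomized and
depending on the past, and given `ℱ t` the reward and the next state have the law prescribed
by `P` for `(s_t, a_t)`. -/
structure IsRun {S A : Type} [MeasurableSpace S] [MeasurableSpace A] (P : MDP S A)
    {Ω : Type*} [mΩ : MeasurableSpace Ω] (μ : Measure Ω) (ℱ : Filtration ℕ mΩ)
    (s : ℕ → Ω → S) (a : ℕ → Ω → A) (r : ℕ → Ω → ℝ) : Prop where
  measurable_state : ∀ t, Measurable[ℱ t] (s t)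
  measurable_action : ∀ t, Measurable[ℱ t] (a t)
  measurable_reward : ∀ t, Measurable[ℱ (t + 1)] (r t)
  cond_law : ∀ t, ∀ B : Set (ℝ × S), MeasurableSet B →
    μ[fun ω => B.indicator (fun _ => (1 : ℝ)) (r t ω, s (t + 1) ω) | ℱ t]
      =ᵐ[μ] fun ω => (P.law (s t ω) (a t ω)).real B

/-- The conditions on learning rates: `α i ∈ [0, 1)`, `∑ α i = ∞`, `∑ (α i)² < ∞`. -/
structure LearningRateRules (α : ℕ → ℝ) : Prop where
  nonneg : ∀ i, 0 ≤ α i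
  lt_one : ∀ i, α i < 1
  sum_eq_top : Tendsto (fun n => ∑ i ∈ Finset.range n, α i) atTop atTop
  sum_sq_lt_top : Summable fun i => α i ^ 2

/-- The time `t^i` of the `i`-th visit (counted from `0`) of the pair `(x, b)`. -/
def visitTime {S A : Type} (s : ℕ → S) (a : ℕ → A) (x : S) (b : A) (i : ℕ) : ℕ :=
  Nat.nth (fun t => s t = x ∧ a t = b) i

end AntiJamming

end

/-! Fix a run and put `x t z = Q_t z - Q^* z` for a pair `z`. With `α t z` equal to `τ t` on the
visited pair and to `0` elsewhere, every coordinate obeys `x (t+1) z = (1 - α t z) * x t z + α t z *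
(h t z + w t)`. Here `h` is the mean of the update error and `w` the deviation of the sampled target
from its mean. Three facts give convergence. By Bellman's equation (`MDP.optValue_eq`) `V^*` is the
maximum of `Q^*`, and since maxima and averages are nonexpansive, `|h| ≤ γ B` whenever all
coordinates of `x` are bounded by `B`. Bounded rewards and rates in `[0, 1]` keep the table bounded
(`abs_qLearning_le`). Hence the terms `α w` are martingale differences with square summable bounds,
and their series converges almost surely (`ae_exists_tendsto_sum_of_martingale_diff`). The rest is
pathwise (`tendsto_zero_of_contraction`): an eventual bound `B` on the error improves to `(1 + γ) /
2 * B`, because `∑ α = ∞` forgets the past and the tail of the noise series is negligible; iterate.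
-/

namespace AntiJamming

/-! ### Deterministic stochastic approximation -/

/-- A recursion `x (t + 1) ≤ (1 - α t) * x t + α t * c` with `∑ α = ∞` eventually drives `x` below
every number above `c`. -/
theorem eventually_le_of_averaging {x α : ℕ → ℝ} {c c' : ℝ} (hc : c < c')
    (hα1 : ∀ t, α t ≤ 1)
    (hα : Tendsto (fun n => ∑ i ∈ Finset.range n, α i) atTop atTop)
    (hx : ∀ᶠ t in atTop, x (t + 1) ≤ (1 - α t) * x t + α t * c) :
    ∀ᶠ t in atTop, x t ≤ c' := by
  obtain ⟨T, hT⟩ := eventually_atTop.1 hx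
  -- The positive part makes the bound nonnegative, so that `1 - α t` can be replaced by the larger
  -- `exp (-α t)`.
  set y : ℝ := max (x T - c) 0 with hy
  have hy0 : 0 ≤ y := le_max_right _ _
  have key : ∀ t, T ≤ t → x t - c ≤
      y * Real.exp (-(∑ i ∈ Finset.range t, α i - ∑ i ∈ Finset.range T, α i)) := by
    intro t ht
    induction t, ht using Nat.le_induction with
    | base => simp [hy]
    | succ t ht ih =>
      have h1 := hT t ht
      have h2 : x (t + 1) - c ≤ (1 - α t) * (x t - c) := by linarith
      have h3 : 1 - α t ≤ Real.exp (-α t) := by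
        have := Real.add_one_le_exp (-α t); linarith
      have h4 : 0 ≤ 1 - α t := by linarith [hα1 t]
      rw [Finset.sum_range_succ]
      calc x (t + 1) - c ≤ (1 - α t) * (x t - c) := h2
        _ ≤ (1 - α t) *
            (y * Real.exp (-(∑ i ∈ Finset.range t, α i - ∑ i ∈ Finset.range T, α i))) := by
          gcongr
        _ ≤ Real.exp (-α t) *
            (y * Real.exp (-(∑ i ∈ Finset.range t, α i - ∑ i ∈ Finset.range T, α i))) := by
          gcongr
        _ = _ := by
          rw [mul_left_comm, ← Real.exp_add]; congr 2; ring
  have hlim : Tendsto (fun t => y *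
      Real.exp (-(∑ i ∈ Finset.range t, α i - ∑ i ∈ Finset.range T, α i))) atTop (𝓝 0) := by
    have h1 : Tendsto (fun t => ∑ i ∈ Finset.range t, α i - ∑ i ∈ Finset.range T, α i)
        atTop atTop := tendsto_atTop_add_const_right _ _ hα
    simpa using (Real.tendsto_exp_neg_atTop_nhds_zero.comp h1).const_mul y
  filter_upwards [hlim.eventually_lt_const (sub_pos.2 hc), eventually_ge_atTop T] with t h1 h2
  have := key t h2
  linarith

/-- Asynchronous stochastic approximation of the fixed point `0` of a `γ`-contraction in the
maximum norm, along a bounded trajectory with summable noise. -/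
theorem tendsto_zero_of_contraction {Z : Type*} [Finite Z] {γ C : ℝ} (hγ0 : 0 ≤ γ) (hγ1 : γ < 1)
    {x α w h : ℕ → Z → ℝ}
    (hα0 : ∀ t z, 0 ≤ α t z) (hα1 : ∀ t z, α t z ≤ 1)
    (hα : ∀ z, Tendsto (fun n => ∑ i ∈ Finset.range n, α i z) atTop atTop)
    (hw : ∀ z, ∃ l, Tendsto (fun n => ∑ i ∈ Finset.range n, α i z * w i z) atTop (𝓝 l))
    (hx : ∀ t z, x (t + 1) z = (1 - α t z) * x t z + α t z * (h t z + w t z))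
    (hh : ∀ t B, (∀ z, |x t z| ≤ B) → ∀ z, |h t z| ≤ γ * B)
    (hC : ∀ t z, |x t z| ≤ C) (z : Z) :
    Tendsto (fun t => x t z) atTop (𝓝 0) := by
  choose l hl using hw
  have step : ∀ B, 0 < B → (∀ᶠ t in atTop, ∀ z, |x t z| ≤ B) →
      ∀ᶠ t in atTop, ∀ z, |x t z| ≤ (1 + γ) / 2 * B := by
    intro B hB hev
    rw [eventually_all]
    intro z
    -- The target is `(1 + γ) / 2 * B = γ * B + 4 * ε`; the argument spends `3 * ε`: two in the
    -- averaging lemma, one on the noise tail.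
    set ε : ℝ := (1 - γ) * B / 8 with hε
    have hε0 : 0 < ε := by have : 0 < 1 - γ := by linarith
                           positivity
    -- Minus the tail of the noise series. Since `e (t + 1) - e t = α t z * w t z`, the shifted
    -- error `x - e` follows a recursion without noise, with `h - e` in place of `h`.
    set e : ℕ → ℝ := fun n => ∑ i ∈ Finset.range n, α i z * w i z - l z with he
    have he0 : Tendsto e atTop (𝓝 0) := by
      simpa [he] using (hl z).sub_const (l z)
    have hesmall : ∀ᶠ t in atTop, |e t| < ε := by
      have := he0.abs
      rw [abs_zero] at this
      exact this.eventually_lt_const hε0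
    have hrec : ∀ᶠ t in atTop, |x (t + 1) z - e (t + 1)| ≤
        (1 - α t z) * |x t z - e t| + α t z * (γ * B + ε) := by
      filter_upwards [hev, hesmall] with t h1 h2
      have h3 : x (t + 1) z - e (t + 1) =
          (1 - α t z) * (x t z - e t) + α t z * (h t z - e t) := by
        simp only [he, Finset.sum_range_succ, hx]; ring
      have h4 : |h t z - e t| ≤ γ * B + ε := by
        have := hh t B h1 z
        have := abs_sub (h t z) (e t)
        linarith
      rw [h3]
      refine (abs_add_le _ _).trans ?_
      rw [abs_mul, abs_mul, abs_of_nonneg (hα0 t z),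
        abs_of_nonneg (sub_nonneg.2 (hα1 t z))]
      have := hα0 t z
      gcongr
    have := eventually_le_of_averaging (x := fun t => |x t z - e t|)
      (show γ * B + ε < γ * B + 2 * ε by linarith) (fun t => hα1 t z)
      (hα z) hrec
    filter_upwards [this, hesmall] with t h1 h2
    have h3 : |x t z| ≤ |x t z - e t| + |e t| := by
      simpa using abs_add_le (x t z - e t) (e t)
    simp only [hε] at *
    linarith
  -- `step` needs a strictly positive bound, and `C` may be `0`.
  have hC0 : 0 < |C| + 1 := by positivity
  set ρ : ℝ := (1 + γ) / 2 with hρ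
  have hρ0 : 0 < ρ := by rw [hρ]; linarith
  have hρ1 : ρ < 1 := by rw [hρ]; linarith
  have iter : ∀ k : ℕ, ∀ᶠ t in atTop, ∀ z, |x t z| ≤ ρ ^ k * (|C| + 1) := by
    intro k
    induction k with
    | zero =>
      refine Eventually.of_forall fun t z => ?_
      have := hC t z
      have := le_abs_self C
      simp only [pow_zero, one_mul]
      linarith
    | succ k ih =>
      have := step _ (by positivity) ih
      rw [pow_succ', mul_assoc]
      exact this
  rw [Metric.tendsto_atTop']
  intro ε hε
  have hlim : Tendsto (fun k : ℕ => ρ ^ k * (|C| + 1)) atTop (𝓝 0) := by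
    simpa using (tendsto_pow_atTop_nhds_zero_of_lt_one hρ0.le hρ1).mul_const (|C| + 1)
  obtain ⟨k, hk⟩ := (hlim.eventually_lt_const hε).exists
  obtain ⟨N, hN⟩ := eventually_atTop.1 (iter k)
  refine ⟨N, fun n hn => ?_⟩
  rw [Real.dist_eq, sub_zero]
  exact (hN n hn.le z).trans_lt hk

/-! ### Sums over visit times, and maxima over actions -/

theorem sum_range_ite_eq_sum_nth (p : ℕ → Prop) [DecidablePred p] (f : ℕ → ℝ) (n : ℕ) :
    ∑ t ∈ Finset.range n, (if p t then f t else 0) =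
      ∑ i ∈ Finset.range (Nat.count p n), f (Nat.nth p i) := by
  induction n with
  | zero => simp
  | succ n ih =>
    rw [Finset.sum_range_succ, ih, Nat.count_succ]
    split_ifs with h
    · rw [Finset.sum_range_succ, Nat.nth_count h]
    · simp

theorem tendsto_count_atTop {p : ℕ → Prop} [DecidablePred p] (hp : {t | p t}.Infinite) :
    Tendsto (Nat.count p) atTop atTop := by
  refine tendsto_atTop_atTop_of_monotone (Nat.count_monotone p) fun n => ⟨Nat.nth p n, ?_⟩
  rw [Nat.count_nth_of_infinite hp]

theorem tendsto_sum_ite_atTop {p : ℕ → Prop} [DecidablePred p] (hp : {t | p t}.Infinite)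
    {f : ℕ → ℝ}
    (hf : Tendsto (fun n => ∑ i ∈ Finset.range n, f (Nat.nth p i)) atTop atTop) :
    Tendsto (fun n => ∑ t ∈ Finset.range n, if p t then f t else 0) atTop atTop := by
  simp_rw [sum_range_ite_eq_sum_nth]
  exact hf.comp (tendsto_count_atTop hp)

/-- Infinitely many visits are not needed: a partial sum uses only genuine values of `Nat.nth`, and
its default values merely add nonnegative terms to the bound. -/
theorem summable_ite_of_summable_nth {p : ℕ → Prop} [DecidablePred p] {f : ℕ → ℝ}
    (hf0 : ∀ t, 0 ≤ f t) (hf : Summable fun i => f (Nat.nth p i)) :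
    Summable fun t => if p t then f t else 0 := by
  refine summable_of_sum_range_le (c := ∑' i, f (Nat.nth p i)) (fun t => ?_) fun n => ?_
  · split_ifs
    · exact hf0 t
    · exact le_rfl
  · rw [sum_range_ite_eq_sum_nth]
    exact hf.sum_le_tsum _ fun i _ => hf0 _

/-- Nonexpansiveness of the maximum is used twice: for the Bellman operator, and for the drift of
the Q-learning error. -/
theorem abs_sup'_sub_sup'_le {A : Type*} [Fintype A] [Nonempty A] {f g : A → ℝ} {B : ℝ}
    (h : ∀ a, |f a - g a| ≤ B) :
    |Finset.univ.sup' Finset.univ_nonempty f - Finset.univ.sup' Finset.univ_nonempty g| ≤ B := by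
  have key : ∀ f g : A → ℝ, (∀ a, |f a - g a| ≤ B) →
      Finset.univ.sup' Finset.univ_nonempty f ≤ B + Finset.univ.sup' Finset.univ_nonempty g := by
    intro f g h
    refine Finset.sup'_le _ _ fun a _ => ?_
    have h1 := Finset.le_sup' g (Finset.mem_univ a)
    have h2 := (abs_le.1 (h a)).2
    linarith
  have h1 := key f g h
  have h2 := key g f fun a => by rw [abs_sub_comm]; exact h a
  rw [abs_le]
  constructor <;> linarith

theorem abs_sup'_le {A : Type*} [Fintype A] [Nonempty A] {f : A → ℝ} {B : ℝ}
    (h : ∀ a, |f a| ≤ B) : |Finset.univ.sup' Finset.univ_nonempty f| ≤ B := by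
  have := abs_sup'_sub_sup'_le (f := f) (g := fun _ => 0) (B := B) (by simpa using h)
  simpa using this

/-! ### Bellman's optimality equation -/

section

variable {S A : Type} [MeasurableSpace S] (P : MDP S A)

theorem MDP.trans_nonneg (s : S) (a : A) (s' : S) : 0 ≤ P.trans s a s' := measureReal_nonneg

variable [Fintype S]

theorem MDP.sum_trans [MeasurableSingletonClass S] (s : S) (a : A) :
    ∑ s', P.trans s a s' = 1 := by
  classical
  have := P.isProb s a
  have h1 : ∑ s', P.trans s a s' = (P.law s a).real (⋃ s' : S, {x : ℝ × S | x.2 = s'}) := by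
    rw [measureReal_iUnion_fintype]
    · rfl
    · intro i j hij
      refine Set.disjoint_left.2 fun x hx hx' => hij ?_
      exact hx.symm.trans hx'
    · intro s'
      exact measurable_snd (measurableSet_singleton s')
  have h2 : (⋃ s' : S, {x : ℝ × S | x.2 = s'}) = Set.univ := by
    ext x; simp
  rw [h1, h2, probReal_univ]

variable [MeasurableSingletonClass S]

theorem MDP.abs_sum_trans_mul_le (s : S) (a : A) {f : S → ℝ} {B : ℝ} (h : ∀ s', |f s'| ≤ B) :
    |∑ s', P.trans s a s' * f s'| ≤ B := by
  calc |∑ s', P.trans s a s' * f s'| ≤ ∑ s', |P.trans s a s' * f s'| :=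
        Finset.abs_sum_le_sum_abs _ _
    _ ≤ ∑ s', P.trans s a s' * B := by
        refine Finset.sum_le_sum fun s' _ => ?_
        rw [abs_mul, abs_of_nonneg (P.trans_nonneg s a s')]
        exact mul_le_mul_of_nonneg_left (h s') (P.trans_nonneg s a s')
    _ = B := by rw [← Finset.sum_mul, P.sum_trans, one_mul]

theorem MDP.abs_sum_trans_mul_sub_le (s : S) (a : A) {f g : S → ℝ} {B : ℝ}
    (h : ∀ s', |f s' - g s'| ≤ B) :
    |∑ s', P.trans s a s' * f s' - ∑ s', P.trans s a s' * g s'| ≤ B := by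
  rw [← Finset.sum_sub_distrib]
  simp_rw [← mul_sub]
  exact P.abs_sum_trans_mul_le s a h

/-- Split off the term `t = 0` of the series and exchange the remaining sum with the finite sum over
next states; bounded expected rewards and `γ < 1` give summability. -/
theorem MDP.value_eq (π : S → A) (s : S) :
    P.value π s = P.meanReward s (π s) + P.γ * ∑ s', P.trans s (π s) s' * P.value π s' := by
  obtain ⟨R, hR⟩ := (Set.finite_range fun s => |P.meanReward s (π s)|).bddAbove
  have hR' : ∀ t s, |P.expReward π t s| ≤ R := by
    intro t
    induction t with
    | zero => exact fun s => hR ⟨s, rfl⟩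
    | succ t ih => exact fun s => P.abs_sum_trans_mul_le s (π s) ih
  have hsum : ∀ s, Summable fun t : ℕ => P.γ ^ t * P.expReward π t s := by
    intro s
    refine Summable.of_norm_bounded
      ((summable_geometric_of_lt_one P.γ_nonneg P.γ_lt_one).mul_right R) fun t => ?_
    rw [Real.norm_eq_abs, abs_mul, abs_of_nonneg (pow_nonneg P.γ_nonneg t)]
    exact mul_le_mul_of_nonneg_left (hR' t s) (pow_nonneg P.γ_nonneg t)
  unfold MDP.value
  rw [(hsum s).tsum_eq_zero_add, pow_zero, one_mul]
  congr 1
  simp_rw [← tsum_mul_left]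
  rw [← Summable.tsum_finsetSum fun s' _ => (hsum s').mul_left _, ← tsum_mul_left]
  refine tsum_congr fun t => ?_
  change _ * (∑ s', P.trans s (π s) s' * P.expReward π t s') = _
  rw [pow_succ', mul_assoc, Finset.mul_sum]
  congr 1
  exact Finset.sum_congr rfl fun _ _ => mul_left_comm _ _ _

/-- The comparison principle for policy evaluation. -/
theorem MDP.le_of_le_add_mul_sum (π : S → A) {u v : S → ℝ}
    (h : ∀ s, u s - v s ≤ P.γ * ∑ s', P.trans s (π s) s' * (u s' - v s')) (s : S) :
    u s ≤ v s := by
  have : Nonempty S := ⟨s⟩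
  -- At a maximizer the difference `u - v` is at most `γ` times itself, hence nonpositive.
  obtain ⟨m, hm⟩ := Finite.exists_max fun s => u s - v s
  have h1 : ∑ s', P.trans m (π m) s' * (u s' - v s') ≤ u m - v m := by
    calc _ ≤ ∑ s', P.trans m (π m) s' * (u m - v m) :=
          Finset.sum_le_sum fun s' _ =>
            mul_le_mul_of_nonneg_left (hm s') (P.trans_nonneg m (π m) s')
      _ = _ := by rw [← Finset.sum_mul, P.sum_trans, one_mul]
  have h2 := (h m).trans (mul_le_mul_of_nonneg_left h1 P.γ_nonneg)
  have h3 : u m - v m ≤ 0 := by nlinarith [P.γ_lt_one]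
  linarith [hm s]

variable [Fintype A] [Nonempty A]

theorem MDP.exists_bellman_fixedPoint : ∃ v : S → ℝ, ∀ s,
    v s = Finset.univ.sup' Finset.univ_nonempty fun a =>
      P.meanReward s a + P.γ * ∑ s', P.trans s a s' * v s' := by
  let T : (S → ℝ) → S → ℝ := fun v s => Finset.univ.sup' Finset.univ_nonempty fun a =>
      P.meanReward s a + P.γ * ∑ s', P.trans s a s' * v s'
  have hT : ContractingWith ⟨P.γ, P.γ_nonneg⟩ T := by
    refine ⟨P.γ_lt_one, LipschitzWith.of_dist_le_mul fun u v => ?_⟩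
    refine (dist_pi_le_iff (mul_nonneg P.γ_nonneg dist_nonneg)).2 fun s => ?_
    rw [Real.dist_eq]
    refine abs_sup'_sub_sup'_le fun a => ?_
    rw [add_sub_add_left_eq_sub, ← mul_sub, abs_mul, abs_of_nonneg P.γ_nonneg]
    refine mul_le_mul_of_nonneg_left (P.abs_sum_trans_mul_sub_le s a fun s' => ?_) P.γ_nonneg
    exact (Real.dist_eq _ _).symm.le.trans (dist_le_pi_dist u v s')
  exact ⟨hT.fixedPoint, fun s => (congrFun hT.fixedPoint_isFixedPt s).symm⟩

/-- Bellman's optimality equation. -/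
theorem MDP.optValue_eq (s : S) :
    P.optValue s = Finset.univ.sup' Finset.univ_nonempty (P.optQ s) := by
  obtain ⟨v, hv⟩ := P.exists_bellman_fixedPoint
  -- The fixed point dominates every policy, and the policy greedy for `v` attains it; so the
  -- supremum over policies equals `v`.
  have hle : ∀ π s, P.value π s ≤ v s := by
    intro π
    refine P.le_of_le_add_mul_sum π fun s => ?_
    have h1 : P.meanReward s (π s) + P.γ * ∑ s', P.trans s (π s) s' * v s' ≤ v s := by
      rw [hv s]
      exact Finset.le_sup' (fun a => P.meanReward s a + P.γ * ∑ s', P.trans s a s' * v s')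
        (Finset.mem_univ (π s))
    have h2 := P.value_eq π s
    simp_rw [mul_sub, Finset.sum_sub_distrib, mul_sub]
    linarith
  have hgreedy : ∀ s, ∃ a, v s = P.meanReward s a + P.γ * ∑ s', P.trans s a s' * v s' := by
    intro s
    obtain ⟨a, _, ha⟩ := Finset.exists_mem_eq_sup' Finset.univ_nonempty fun a =>
      P.meanReward s a + P.γ * ∑ s', P.trans s a s' * v s'
    exact ⟨a, (hv s).trans ha⟩
  choose π hπ using hgreedy
  have hge : ∀ s, v s ≤ P.value π s := by
    refine P.le_of_le_add_mul_sum π fun s => ?_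
    have h1 := hπ s
    have h2 := P.value_eq π s
    simp_rw [mul_sub, Finset.sum_sub_distrib, mul_sub]
    linarith
  have hopt : ∀ s, P.optValue s = v s := fun s =>
    le_antisymm (ciSup_le fun π => hle π s)
      ((hge s).trans (le_ciSup (f := fun π => P.value π s)
        ⟨v s, by rintro _ ⟨π, rfl⟩; exact hle π s⟩ π))
  rw [hopt, hv]
  unfold MDP.optQ
  simp_rw [hopt]

end

/-! ### Martingale convergence -/

/-- A series of bounded martingale differences with square summable bounds converges almost
surely. -/
theorem ae_exists_tendsto_sum_of_martingale_diff {Ω : Type*} {mΩ : MeasurableSpace Ω}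
    {μ : Measure Ω} [IsProbabilityMeasure μ] {ℱ : Filtration ℕ mΩ} {d : ℕ → Ω → ℝ} {c : ℕ → ℝ}
    (hmeas : ∀ t, Measurable[ℱ (t + 1)] (d t)) (hbdd : ∀ t, ∀ᵐ ω ∂μ, |d t ω| ≤ c t)
    (hc : Summable fun t => c t ^ 2) (hcond : ∀ t, μ[d t | ℱ t] =ᵐ[μ] 0) :
    ∀ᵐ ω ∂μ, ∃ l, Tendsto (fun n => ∑ t ∈ Finset.range n, d t ω) atTop (𝓝 l) := by
  set M : ℕ → Ω → ℝ := fun n ω => ∑ t ∈ Finset.range n, d t ω with hM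
  have hMmeas : ∀ n, StronglyMeasurable[ℱ n] (M n) := by
    intro n
    refine Measurable.stronglyMeasurable ?_
    refine Finset.measurable_fun_sum _ fun t ht => ?_
    exact (hmeas t).mono (ℱ.mono (Finset.mem_range.1 ht)) le_rfl
  have hdmeas : ∀ t, AEStronglyMeasurable (d t) μ := fun t =>
    ((hmeas t).mono (ℱ.le _) le_rfl).aestronglyMeasurable
  have hMmeas' : ∀ n, AEStronglyMeasurable (M n) μ := fun n =>
    ((hMmeas n).mono (ℱ.le n)).aestronglyMeasurable
  have hMbdd : ∀ n, ∀ᵐ ω ∂μ, |M n ω| ≤ ∑ t ∈ Finset.range n, c t := by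
    intro n
    filter_upwards [ae_all_iff.2 hbdd] with ω hω
    exact (Finset.abs_sum_le_sum_abs _ _).trans (Finset.sum_le_sum fun t _ => hω t)
  have hdint : ∀ t, Integrable (d t) μ := fun t => .of_bound (hdmeas t) (c t) (hbdd t)
  have hMint : ∀ n, Integrable (M n) μ := fun n => .of_bound (hMmeas' n) _ (hMbdd n)
  have hMd : ∀ n, Integrable (fun ω => M n ω * d n ω) μ := fun n =>
    (hdint n).bdd_mul (hMmeas' n) (hMbdd n)
  have hM2 : ∀ n, Integrable (fun ω => M n ω ^ 2) μ := fun n => by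
    simpa [pow_two] using (hMint n).bdd_mul (hMmeas' n) (hMbdd n)
  have hd2 : ∀ n, Integrable (fun ω => d n ω ^ 2) μ := fun n => by
    simpa [pow_two] using (hdint n).bdd_mul (hdmeas n) (hbdd n)
  have hmart : Martingale M ℱ μ := by
    refine martingale_of_condExp_sub_eq_zero_nat hMmeas hMint fun n => ?_
    have : M (n + 1) - M n = d n := by
      ext ω; simp [hM, Finset.sum_range_succ]
    rw [this]
    exact hcond n
  have horth : ∀ n, ∫ ω, M n ω * d n ω ∂μ = 0 := by
    intro n
    rw [← integral_condExp (ℱ.le n)]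
    have h1 := condExp_mul_of_stronglyMeasurable_left (hMmeas n) (hMd n) (hdint n)
    have h2 : μ[fun ω => M n ω * d n ω | ℱ n] =ᵐ[μ] 0 := by
      refine h1.trans ?_
      filter_upwards [hcond n] with ω hω
      simp [hω]
    rw [integral_congr_ae h2]
    simp
  have hL2 : ∀ n, ∫ ω, M n ω ^ 2 ∂μ ≤ ∑ t ∈ Finset.range n, c t ^ 2 := by
    intro n
    induction n with
    | zero => simp [hM]
    | succ n ih =>
      have h1 : ∀ ω, M (n + 1) ω ^ 2 = M n ω ^ 2 + 2 * (M n ω * d n ω) + d n ω ^ 2 := by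
        intro ω
        simp only [hM, Finset.sum_range_succ]
        ring
      have h2 : ∫ ω, d n ω ^ 2 ∂μ ≤ c n ^ 2 := by
        have : ∫ ω, d n ω ^ 2 ∂μ ≤ ∫ _, c n ^ 2 ∂μ := by
          refine integral_mono_ae (hd2 n) (integrable_const _) ?_
          filter_upwards [hbdd n] with ω hω
          exact sq_le_sq' (abs_le.1 hω).1 (abs_le.1 hω).2
        simpa using this
      have h3 : Integrable (fun ω => 2 * (M n ω * d n ω)) μ := (hMd n).const_mul 2
      have h4 : Integrable (fun ω => M n ω ^ 2 + 2 * (M n ω * d n ω)) μ := (hM2 n).add h3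
      simp_rw [h1]
      rw [integral_add h4 (hd2 n), integral_add (hM2 n) h3, integral_const_mul, horth,
        Finset.sum_range_succ]
      linarith
  -- Doob's theorem asks for an `L¹` bound; it follows from the `L²` bound by `|m| ≤ 1 + m ^ 2`.
  have hL1 : ∀ n, eLpNorm (M n) 1 μ ≤ (1 + ∑' t, c t ^ 2).toNNReal := by
    intro n
    rw [eLpNorm_one_eq_lintegral_enorm, ← ofReal_integral_norm_eq_lintegral_enorm (hMint n)]
    refine ENNReal.ofReal_le_ofReal ?_
    calc ∫ ω, ‖M n ω‖ ∂μ ≤ ∫ ω, (1 + M n ω ^ 2) ∂μ := by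
          refine integral_mono (hMint n).norm ((integrable_const _).add (hM2 n)) fun ω => ?_
          simp only [Real.norm_eq_abs]
          rw [← sq_abs]
          nlinarith [sq_nonneg (|M n ω| - 1), abs_nonneg (M n ω)]
      _ = 1 + ∫ ω, M n ω ^ 2 ∂μ := by
          rw [integral_add (integrable_const _) (hM2 n)]; simp
      _ ≤ 1 + ∑' t, c t ^ 2 := by
          have := (hL2 n).trans (hc.sum_le_tsum _ fun t _ => sq_nonneg (c t))
          linarith
  filter_upwards [hmart.submartingale.ae_tendsto_limitProcess hL1] with ω hω
  exact ⟨_, hω⟩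

/-! ### Conditional laws along a run -/

section

variable {S A : Type} [MeasurableSpace S] [MeasurableSpace A] {P : MDP S A}
  {Ω : Type*} {mΩ : MeasurableSpace Ω} {μ : Measure Ω}
  {ℱ : Filtration ℕ mΩ} {s : ℕ → Ω → S} {a : ℕ → Ω → A} {r : ℕ → Ω → ℝ}

theorem IsRun.measurable_outcome (hrun : IsRun P μ ℱ s a r) (t : ℕ) :
    Measurable[ℱ (t + 1)] fun ω => (r t ω, s (t + 1) ω) :=
  (hrun.measurable_reward t).prodMk (hrun.measurable_state (t + 1))

/-- On an event of the past on which the pair `(x, b)` is active, reward and next state are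
distributed according to `P.law x b`. -/
theorem IsRun.map_restrict [IsProbabilityMeasure μ] (hrun : IsRun P μ ℱ s a r) {t : ℕ} {x : S}
    {b : A} {G : Set Ω}
    (hG : MeasurableSet[ℱ t] G) (hGxb : ∀ ω ∈ G, s t ω = x ∧ a t ω = b) :
    (μ.restrict G).map (fun ω => (r t ω, s (t + 1) ω)) = μ G • P.law x b := by
  have hout := (hrun.measurable_outcome t).mono (ℱ.le _) le_rfl
  have := P.isProb x b
  have hfin : IsFiniteMeasure (μ G • P.law x b) := Measure.smul_finite _ (measure_ne_top _ _)
  have := Measure.isFiniteMeasure_map (μ.restrict G) fun ω => (r t ω, s (t + 1) ω)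
  ext B hB
  rw [← ENNReal.toReal_eq_toReal_iff' (measure_ne_top _ _) (measure_ne_top _ _),
    Measure.map_apply hout hB, Measure.smul_apply, smul_eq_mul, ENNReal.toReal_mul]
  set f : Ω → ℝ := fun ω => B.indicator (fun _ => (1 : ℝ)) (r t ω, s (t + 1) ω) with hf
  have hfind : f = ((fun ω => (r t ω, s (t + 1) ω)) ⁻¹' B).indicator fun _ => (1 : ℝ) := by
    rfl
  have hfint : Integrable f μ := by
    rw [hfind]
    exact (integrable_const _).indicator (hout hB)
  have h1 : ∫ ω in G, f ω ∂μ = ∫ _ in G, (P.law x b).real B ∂μ := by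
    rw [← setIntegral_condExp (ℱ.le t) hfint hG]
    refine setIntegral_congr_ae (ℱ.le t _ hG) ?_
    filter_upwards [hrun.cond_law t B hB] with ω hω hωG
    rw [hω, (hGxb ω hωG).1, (hGxb ω hωG).2]
  rw [hfind, integral_indicator (hout hB)] at h1
  simpa [Measure.real] using h1

variable [MeasurableSingletonClass S]

theorem IsRun.condExp_next_state [DecidableEq S] (hrun : IsRun P μ ℱ s a r) (t : ℕ) (x : S) :
    μ[fun ω => if s (t + 1) ω = x then (1 : ℝ) else 0 | ℱ t] =ᵐ[μ]
      fun ω => P.trans (s t ω) (a t ω) x := by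
  refine EventuallyEq.trans (Eq.eventuallyEq ?_)
    (hrun.cond_law t {y | y.2 = x} (measurable_snd (measurableSet_singleton x)))
  congr 1
  ext ω
  simp [Set.indicator]

variable [MeasurableSingletonClass A]

theorem IsRun.measurableSet_pair (hrun : IsRun P μ ℱ s a r) (t : ℕ) (x : S) (b : A) :
    MeasurableSet[ℱ t] {ω | s t ω = x ∧ a t ω = b} :=
  (hrun.measurable_state t (measurableSet_singleton x)).inter
    (hrun.measurable_action t (measurableSet_singleton b))

variable [IsProbabilityMeasure μ]

theorem IsRun.ae_abs_reward_le [Finite S] [Finite A] (hrun : IsRun P μ ℱ s a r) {R : ℝ}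
    (hR : ∀ x b, ∀ᵐ y ∂(P.law x b), |y.1| ≤ R) : ∀ᵐ ω ∂μ, ∀ t, |r t ω| ≤ R := by
  rw [ae_all_iff]
  intro t
  have hout := (hrun.measurable_outcome t).mono (ℱ.le _) le_rfl
  have h : ∀ x b, ∀ᵐ ω ∂μ, (s t ω = x ∧ a t ω = b) → |r t ω| ≤ R := by
    intro x b
    have hG := hrun.measurableSet_pair t x b
    refine (ae_restrict_iff' (ℱ.le t _ hG)).1 ?_
    refine ae_of_ae_map (f := fun ω => (r t ω, s (t + 1) ω)) (p := fun y => |y.1| ≤ R)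
      hout.aemeasurable ?_
    rw [hrun.map_restrict hG fun ω hω => hω]
    exact Measure.ae_smul_measure (hR x b) _
  have := ae_all_iff.2 fun x => ae_all_iff.2 (h x)
  filter_upwards [this] with ω hω
  exact hω _ _ ⟨rfl, rfl⟩

/-- `cond_law` speaks of events only. Cutting a past event by the finitely many values of the
current pair reduces the claim to `IsRun.map_restrict`, which gives the whole law of the outcome on
each piece. -/
theorem IsRun.condExp_reward [Finite S] [Finite A] (hrun : IsRun P μ ℱ s a r) (t : ℕ) :
    μ[r t | ℱ t] =ᵐ[μ] fun ω => P.meanReward (s t ω) (a t ω) := by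
  classical
  cases nonempty_fintype S
  cases nonempty_fintype A
  obtain ⟨R, hR⟩ := P.bounded
  have hout := (hrun.measurable_outcome t).mono (ℱ.le _) le_rfl
  have hrint : Integrable (r t) μ :=
    .of_bound hout.fst.aestronglyMeasurable R
      ((hrun.ae_abs_reward_le hR).mono fun ω hω => hω t)
  have hmean : Measurable[ℱ t] fun ω => P.meanReward (s t ω) (a t ω) :=
    (measurable_of_finite fun z : S × A => P.meanReward z.1 z.2).comp
      ((hrun.measurable_state t).prodMk (hrun.measurable_action t))
  have hmeanint : Integrable (fun ω => P.meanReward (s t ω) (a t ω)) μ := by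
    obtain ⟨K, hK⟩ := (Set.finite_range fun z : S × A => |P.meanReward z.1 z.2|).bddAbove
    exact .of_bound (hmean.mono (ℱ.le t) le_rfl).aestronglyMeasurable K
      (.of_forall fun ω => hK ⟨(s t ω, a t ω), rfl⟩)
  symm
  refine ae_eq_condExp_of_forall_setIntegral_eq (ℱ.le t) hrint
    (fun F _ _ => hmeanint.integrableOn) (fun F hF _ => ?_) hmean.aestronglyMeasurable
  have hsplit : F = ⋃ z : S × A, F ∩ {ω | s t ω = z.1 ∧ a t ω = z.2} := by
    ext ω; simp
  have hG : ∀ z : S × A, MeasurableSet[ℱ t] (F ∩ {ω | s t ω = z.1 ∧ a t ω = z.2}) :=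
    fun z => hF.inter (hrun.measurableSet_pair t z.1 z.2)
  have hdisj : Pairwise (Function.onFun Disjoint
      fun z : S × A => F ∩ {ω | s t ω = z.1 ∧ a t ω = z.2}) := by
    intro z z' hzz'
    refine Set.disjoint_left.2 fun ω h h' => hzz' ?_
    exact Prod.ext (h.2.1.symm.trans h'.2.1) (h.2.2.symm.trans h'.2.2)
  rw [hsplit, integral_iUnion_fintype (fun z => ℱ.le t _ (hG z)) hdisj
      fun _ => hmeanint.integrableOn,
    integral_iUnion_fintype (fun z => ℱ.le t _ (hG z)) hdisj fun _ => hrint.integrableOn]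
  refine Finset.sum_congr rfl fun z _ => ?_
  have h1 : ∫ ω in F ∩ {ω | s t ω = z.1 ∧ a t ω = z.2}, r t ω ∂μ =
      ∫ y, y.1 ∂((μ.restrict (F ∩ {ω | s t ω = z.1 ∧ a t ω = z.2})).map
        fun ω => (r t ω, s (t + 1) ω)) := by
    rw [integral_map hout.aemeasurable measurable_fst.aestronglyMeasurable]
  rw [h1, hrun.map_restrict (hG z) fun ω hω => hω.2, integral_smul_measure,
    setIntegral_congr_fun (ℱ.le t _ (hG z)) (g := fun _ => P.meanReward z.1 z.2)
      fun ω hω => by simp only [hω.2.1, hω.2.2]]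
  simp [MDP.meanReward, Measure.real]

end

/-! ### The Q-learning recursion -/

/-- The deviation of the sampled target `ρ + γ v(y)` from its mean when action `b` is performed
in state `x`. -/
noncomputable def MDP.targetNoise {S A : Type} [Fintype S] [MeasurableSpace S] (P : MDP S A)
    (v : S → ℝ) (x : S) (b : A) (ρ : ℝ) (y : S) : ℝ :=
  ρ + P.γ * v y - (P.meanReward x b + P.γ * ∑ x', P.trans x b x' * v x')

theorem MDP.abs_targetNoise_le {S A : Type} [Fintype S] [MeasurableSpace S]
    [MeasurableSingletonClass S] {P : MDP S A} {x : S} {b : A} {v : S → ℝ} {ρ R K C : ℝ} {y : S}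
    (hρ : |ρ| ≤ R) (hK : |P.meanReward x b| ≤ K) (hv : ∀ y, |v y| ≤ C) :
    |P.targetNoise v x b ρ y| ≤ R + K + 2 * (P.γ * C) := by
  have h1 : |P.γ * v y| ≤ P.γ * C := by
    rw [abs_mul, abs_of_nonneg P.γ_nonneg]
    exact mul_le_mul_of_nonneg_left (hv y) P.γ_nonneg
  have h2 : |P.γ * ∑ x', P.trans x b x' * v x'| ≤ P.γ * C := by
    rw [abs_mul, abs_of_nonneg P.γ_nonneg]
    exact mul_le_mul_of_nonneg_left (P.abs_sum_trans_mul_le x b hv) P.γ_nonneg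
  unfold MDP.targetNoise
  rw [abs_le] at *
  constructor <;> linarith [hρ.1, hρ.2, hK.1, hK.2, h1.1, h1.2, h2.1, h2.2]

section QLearning

variable {S A : Type} [DecidableEq S] [DecidableEq A] [Fintype A] [Nonempty A]

theorem qLearning_succ (γ : ℝ) (τ : ℕ → ℝ) (Q₀ : S → A → ℝ) (s : ℕ → S) (a : ℕ → A)
    (r : ℕ → ℝ) (t : ℕ) (x : S) (b : A) :
    qLearning γ τ Q₀ s a r (t + 1) x b =
      qLearning γ τ Q₀ s a r t x b + (if s t = x ∧ a t = b then τ t else 0) *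
        (r t + γ * Finset.univ.sup' Finset.univ_nonempty (qLearning γ τ Q₀ s a r t (s (t + 1)))
          - qLearning γ τ Q₀ s a r t x b) := by
  by_cases h : s t = x ∧ a t = b
  · simp [qLearning, h.1, h.2]
  · have h' : ¬(x = s t ∧ b = a t) := fun h' => h ⟨h'.1.symm, h'.2.symm⟩
    simp [qLearning, h, h']

/-- Each new entry is a convex combination of the old entry and a target, and `R + γ * C ≤ C` keeps
the target in `[-C, C]`. -/
theorem abs_qLearning_le {γ : ℝ} (hγ : 0 ≤ γ) {τ : ℕ → ℝ} (hτ0 : ∀ t, 0 ≤ τ t)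
    (hτ1 : ∀ t, τ t ≤ 1) {Q₀ : S → A → ℝ} {s : ℕ → S} {a : ℕ → A} {r : ℕ → ℝ} {R C : ℝ}
    (hr : ∀ t, |r t| ≤ R) (hQ : ∀ x b, |Q₀ x b| ≤ C) (hRC : R + γ * C ≤ C) (t : ℕ) (x : S) (b : A) :
    |qLearning γ τ Q₀ s a r t x b| ≤ C := by
  induction t generalizing x b with
  | zero => exact hQ x b
  | succ t ih =>
    rw [qLearning_succ]
    set α : ℝ := if s t = x ∧ a t = b then τ t else 0 with hα
    have hα0 : 0 ≤ α := by rw [hα]; split_ifs <;> simp [hτ0]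
    have hα1 : 0 ≤ 1 - α := by rw [hα]; split_ifs <;> simp [hτ1]
    set m := Finset.univ.sup' Finset.univ_nonempty (qLearning γ τ Q₀ s a r t (s (t + 1)))
    set q := qLearning γ τ Q₀ s a r t x b
    have hm : |m| ≤ C := abs_sup'_le fun b' => ih (s (t + 1)) b'
    have h1 : |r t + γ * m| ≤ C := by
      refine ((abs_add_le _ _).trans ?_).trans hRC
      rw [abs_mul, abs_of_nonneg hγ]
      exact add_le_add (hr t) (mul_le_mul_of_nonneg_left hm hγ)
    calc |q + α * (r t + γ * m - q)| = |(1 - α) * q + α * (r t + γ * m)| := by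
          congr 1; ring
      _ ≤ (1 - α) * |q| + α * |r t + γ * m| := by
          refine (abs_add_le _ _).trans ?_
          rw [abs_mul, abs_mul, abs_of_nonneg hα0, abs_of_nonneg hα1]
      _ ≤ (1 - α) * C + α * C :=
          add_le_add (mul_le_mul_of_nonneg_left (ih x b) hα1)
            (mul_le_mul_of_nonneg_left h1 hα0)
      _ = C := by ring

/-- The error of Q-learning follows a stochastic approximation recursion. -/
theorem qLearning_succ_sub_optQ [Fintype S] [MeasurableSpace S] (P : MDP S A) (τ : ℕ → ℝ)
    (Q₀ : S → A → ℝ) (s : ℕ → S) (a : ℕ → A) (r : ℕ → ℝ) (t : ℕ) (x : S) (b : A) :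
    qLearning P.γ τ Q₀ s a r (t + 1) x b - P.optQ x b =
      (1 - if s t = x ∧ a t = b then τ t else 0) *
          (qLearning P.γ τ Q₀ s a r t x b - P.optQ x b) +
        (if s t = x ∧ a t = b then τ t else 0) *
          (P.γ * (∑ y, P.trans x b y *
                Finset.univ.sup' Finset.univ_nonempty (qLearning P.γ τ Q₀ s a r t y) -
              ∑ y, P.trans x b y * P.optValue y) +
            P.targetNoise
              (fun y => Finset.univ.sup' Finset.univ_nonempty (qLearning P.γ τ Q₀ s a r t y))
              (s t) (a t) (r t) (s (t + 1))) := by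
  rw [qLearning_succ]
  split_ifs with h
  · rw [h.1, h.2]
    simp only [MDP.optQ, MDP.targetNoise]
    ring
  · ring

end QLearning

theorem measurable_sup'_univ {Ω A : Type*} {m : MeasurableSpace Ω} [Fintype A] [Nonempty A]
    {f : Ω → A → ℝ} (hf : ∀ b, Measurable fun ω => f ω b) :
    Measurable fun ω => Finset.univ.sup' Finset.univ_nonempty (f ω) := by
  convert Finset.measurable_sup' (Finset.univ_nonempty (α := A)) fun b _ => hf b using 1
  ext ω
  rw [Finset.sup'_apply]

/-! ### Adaptedness, and centring of the noise -/

section Run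

variable {S A : Type} [Fintype S] [MeasurableSpace S] [MeasurableSingletonClass S]
  [MeasurableSpace A] [MeasurableSingletonClass A] {P : MDP S A}
  {Ω : Type*} {mΩ : MeasurableSpace Ω} {μ : Measure Ω}
  {ℱ : Filtration ℕ mΩ} {s : ℕ → Ω → S} {a : ℕ → Ω → A} {r : ℕ → Ω → ℝ}

theorem measurable_apply_of_fintype {m : MeasurableSpace Ω} {v : Ω → S → ℝ} {y : Ω → S}
    (hv : ∀ x, Measurable fun ω => v ω x) (hy : Measurable y) :
    Measurable fun ω => v ω (y ω) :=
  (measurable_from_prod_countable_left (f := fun p : Ω × S => v p.1 p.2) hv).comp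
    (measurable_id.prodMk hy)

theorem IsRun.measurable_comp [Finite A] (hrun : IsRun P μ ℱ s a r) (t : ℕ) (f : S → A → ℝ) :
    Measurable[ℱ t] fun ω => f (s t ω) (a t ω) :=
  (measurable_of_finite fun z : S × A => f z.1 z.2).comp
    ((hrun.measurable_state t).prodMk (hrun.measurable_action t))

theorem IsRun.measurable_targetNoise [Finite A] (hrun : IsRun P μ ℱ s a r) {t : ℕ}
    {v : Ω → S → ℝ} (hv : ∀ x, Measurable[ℱ t] fun ω => v ω x) :
    Measurable[ℱ (t + 1)] fun ω =>
      P.targetNoise (v ω) (s t ω) (a t ω) (r t ω) (s (t + 1) ω) := by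
  have hle := ℱ.mono t.le_succ
  have hv' : ∀ x, Measurable[ℱ (t + 1)] fun ω => v ω x := fun x => (hv x).mono hle le_rfl
  unfold MDP.targetNoise
  refine ((hrun.measurable_reward t).add
    ((measurable_apply_of_fintype hv' (hrun.measurable_state (t + 1))).const_mul _)).sub
    (((hrun.measurable_comp t P.meanReward).mono hle le_rfl).add
      (Measurable.const_mul (Finset.measurable_fun_sum _ fun x _ => ?_) _))
  exact ((hrun.measurable_comp t fun y b => P.trans y b x).mono hle le_rfl).mul (hv' x)

theorem IsRun.condExp_targetNoise [DecidableEq S] [Finite A] [IsProbabilityMeasure μ]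
    (hrun : IsRun P μ ℱ s a r)
    {t : ℕ} {v : Ω → S → ℝ} {C : ℝ} (hv : ∀ x, Measurable[ℱ t] fun ω => v ω x)
    (hC : ∀ᵐ ω ∂μ, ∀ x, |v ω x| ≤ C) :
    μ[fun ω => P.targetNoise (v ω) (s t ω) (a t ω) (r t ω) (s (t + 1) ω) | ℱ t] =ᵐ[μ] 0 := by
  obtain ⟨R, hR⟩ := P.bounded
  have hle := ℱ.le t
  have hrint : Integrable (r t) μ :=
    .of_bound ((hrun.measurable_reward t).mono (ℱ.le _) le_rfl).aestronglyMeasurable R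
      ((hrun.ae_abs_reward_le hR).mono fun ω hω => hω t)
  have hcompint : ∀ f : S → A → ℝ, Integrable (fun ω => f (s t ω) (a t ω)) μ := by
    intro f
    obtain ⟨K, hK⟩ := (Set.finite_range fun z : S × A => |f z.1 z.2|).bddAbove
    exact .of_bound ((hrun.measurable_comp t f).mono hle le_rfl).aestronglyMeasurable K
      (.of_forall fun ω => hK ⟨(s t ω, a t ω), rfl⟩)
  have hcond : ∀ f : S → A → ℝ,
      μ[fun ω => f (s t ω) (a t ω) | ℱ t] = fun ω => f (s t ω) (a t ω) := fun f =>
    condExp_of_stronglyMeasurable hle (hrun.measurable_comp t f).stronglyMeasurable (hcompint f)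
  have hnextint : ∀ x, Integrable (fun ω => if s (t + 1) ω = x then (1 : ℝ) else 0) μ := by
    intro x
    refine .of_bound (Measurable.aestronglyMeasurable ?_) 1 (.of_forall fun ω => ?_)
    · exact Measurable.ite ((hrun.measurable_state (t + 1)).mono (ℱ.le _) le_rfl
        (measurableSet_singleton x)) measurable_const measurable_const
    · split_ifs <;> simp
  let f₁ : Ω → ℝ := fun ω => P.meanReward (s t ω) (a t ω)
  let g : S → Ω → ℝ := fun x ω => if s (t + 1) ω = x then 1 else 0
  let p : S → Ω → ℝ := fun x ω => P.trans (s t ω) (a t ω) x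
  let u : S → Ω → ℝ := fun x ω => P.γ * v ω x
  have hf₁ : μ[r t - f₁ | ℱ t] =ᵐ[μ] 0 := by
    filter_upwards [condExp_sub hrint (hcompint P.meanReward) (ℱ t), hrun.condExp_reward t]
      with ω h1 h2
    rw [h1, Pi.sub_apply, h2, hcond P.meanReward]
    simp
  have hgpint : ∀ x, Integrable (g x - p x) μ := fun x =>
    (hnextint x).sub (hcompint fun y b => P.trans y b x)
  have hgp : ∀ x, μ[g x - p x | ℱ t] =ᵐ[μ] 0 := by
    intro x
    filter_upwards [condExp_sub (hnextint x) (hcompint fun y b => P.trans y b x) (ℱ t),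
      hrun.condExp_next_state t x] with ω h1 h2
    rw [h1, Pi.sub_apply, h2, hcond fun y b => P.trans y b x]
    simp
  have hu : ∀ x, StronglyMeasurable[ℱ t] (u x) := fun x => ((hv x).const_mul _).stronglyMeasurable
  have hugpint : ∀ x, Integrable (u x * (g x - p x)) μ := by
    intro x
    refine (hgpint x).bdd_mul (c := P.γ * C) ((hu x).mono hle).aestronglyMeasurable ?_
    filter_upwards [hC] with ω hω
    rw [Real.norm_eq_abs, abs_mul, abs_of_nonneg P.γ_nonneg]
    exact mul_le_mul_of_nonneg_left (hω x) P.γ_nonneg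
  have hugp : ∀ x, μ[u x * (g x - p x) | ℱ t] =ᵐ[μ] 0 := by
    intro x
    filter_upwards [condExp_mul_of_stronglyMeasurable_left (hu x) (hugpint x) (hgpint x), hgp x]
      with ω h1 h2
    rw [h1, Pi.mul_apply, h2]
    simp
  -- As `v` is itself random, `v (s (t + 1))` is expanded over the finitely many next states: each
  -- indicator, centred by its transition probability, has a coefficient known at time `t`.
  have hdecomp : (fun ω => P.targetNoise (v ω) (s t ω) (a t ω) (r t ω) (s (t + 1) ω)) =
      (r t - f₁) + ∑ x, u x * (g x - p x) := by
    ext ω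
    simp only [MDP.targetNoise, Pi.add_apply, Pi.sub_apply, Finset.sum_apply, Pi.mul_apply,
      f₁, g, p, u, mul_sub, Finset.sum_sub_distrib, mul_ite, mul_one, mul_zero,
      Finset.sum_ite_eq, Finset.mem_univ, if_true, Finset.mul_sum]
    have : ∀ x, P.γ * (P.trans (s t ω) (a t ω) x * v ω x) =
        P.γ * v ω x * P.trans (s t ω) (a t ω) x := fun x => by ring
    simp_rw [this]
    ring
  rw [hdecomp]
  filter_upwards [condExp_add (hrint.sub (hcompint P.meanReward))
      (integrable_finsetSum' Finset.univ fun x _ => hugpint x) (ℱ t),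
    condExp_finsetSum (s := Finset.univ) (fun x _ => hugpint x) (ℱ t), hf₁,
    ae_all_iff.2 hugp] with ω h1 h2 h3 h4
  refine h1.trans ?_
  rw [Pi.add_apply, h2, Finset.sum_apply]
  refine (congrArg₂ (· + ·) h3 (Finset.sum_eq_zero fun x _ => h4 x)).trans ?_
  simp

theorem IsRun.measurable_qLearning [DecidableEq S] [DecidableEq A] [Fintype A] [Nonempty A]
    (hrun : IsRun P μ ℱ s a r) (γ : ℝ) (τ : ℕ → ℝ) (Q₀ : S → A → ℝ) (t : ℕ) (x : S) (b : A) :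
    Measurable[ℱ t] fun ω =>
      qLearning γ τ Q₀ (fun t => s t ω) (fun t => a t ω) (fun t => r t ω) t x b := by
  induction t generalizing x b with
  | zero => exact measurable_const
  | succ t ih =>
    have hle := ℱ.mono t.le_succ
    have hq : ∀ x b, Measurable[ℱ (t + 1)] fun ω =>
        qLearning γ τ Q₀ (fun t => s t ω) (fun t => a t ω) (fun t => r t ω) t x b :=
      fun x b => (ih x b).mono hle le_rfl
    have hm : ∀ x, Measurable[ℱ (t + 1)] fun ω =>
        Finset.univ.sup' Finset.univ_nonempty
          (qLearning γ τ Q₀ (fun t => s t ω) (fun t => a t ω) (fun t => r t ω) t x) := by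
      exact fun x => measurable_sup'_univ (hq x)
    simp_rw [qLearning_succ]
    refine (hq x b).add (Measurable.mul ?_ (((hrun.measurable_reward t).add
      ((measurable_apply_of_fintype hm (hrun.measurable_state (t + 1))).const_mul γ)).sub
      (hq x b)))
    exact Measurable.ite (hle _ (hrun.measurableSet_pair t x b)) measurable_const
      measurable_const

end Run

/-! ### Almost sure convergence -/

/-- If every pair is visited infinitely often under the learning rate rules, the whole sequence of
learning rates lies in `[0, 1)` and is square summable. -/
theorem learningRates_of_visits {S A : Type} [Finite S] [Finite A] {s : ℕ → S} {a : ℕ → A}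
    {τ : ℕ → ℝ}
    (h : ∀ x b, LearningRateRules fun i => τ (visitTime s a x b i)) :
    (∀ t, 0 ≤ τ t) ∧ (∀ t, τ t ≤ 1) ∧ Summable fun t => τ t ^ 2 := by
  classical
  cases nonempty_fintype S
  cases nonempty_fintype A
  -- Every time is a visit time of the pair active then, so conditions on the visits constrain all
  -- of `τ`.
  have hvisit : ∀ t, ∃ i, visitTime s a (s t) (a t) i = t := fun t =>
    ⟨_, Nat.nth_count (p := fun t' => s t' = s t ∧ a t' = a t) ⟨rfl, rfl⟩⟩
  refine ⟨fun t => ?_, fun t => ?_, ?_⟩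
  · obtain ⟨i, hi⟩ := hvisit t
    have := (h (s t) (a t)).nonneg i
    rwa [hi] at this
  · obtain ⟨i, hi⟩ := hvisit t
    have := (h (s t) (a t)).lt_one i
    rw [hi] at this
    exact this.le
  · have h1 : ∀ z : S × A, Summable fun t => if s t = z.1 ∧ a t = z.2 then τ t ^ 2 else 0 :=
      fun z => summable_ite_of_summable_nth (fun t => sq_nonneg (τ t)) (h z.1 z.2).sum_sq_lt_top
    refine (summable_sum fun z (_ : z ∈ Finset.univ) => h1 z).congr fun t => ?_
    rw [Finset.sum_eq_single (s t, a t)]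
    · simp
    · intro z _ hz
      exact if_neg fun h => hz (Prod.ext h.1.symm h.2.symm)
    · simp

/-- Almost sure convergence of tabular Q-learning for a finite decision process. -/
theorem IsRun.ae_tendsto_qLearning {S A : Type} [Fintype S] [DecidableEq S] [MeasurableSpace S]
    [MeasurableSingletonClass S] [Fintype A] [DecidableEq A] [Nonempty A] [MeasurableSpace A]
    [MeasurableSingletonClass A] {P : MDP S A} {Ω : Type*} {mΩ : MeasurableSpace Ω}
    {μ : Measure Ω} [IsProbabilityMeasure μ] {ℱ : Filtration ℕ mΩ}
    {s : ℕ → Ω → S} {a : ℕ → Ω → A} {r : ℕ → Ω → ℝ} (hrun : IsRun P μ ℱ s a r) {τ : ℕ → ℝ}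
    (hτ : ∀ᵐ ω ∂μ, ∀ x b, {t : ℕ | s t ω = x ∧ a t ω = b}.Infinite ∧
      LearningRateRules fun i => τ (visitTime (fun t => s t ω) (fun t => a t ω) x b i))
    (Q₀ : S → A → ℝ) :
    ∀ᵐ ω ∂μ, ∀ x b, Tendsto
      (fun t => qLearning P.γ τ Q₀ (fun t => s t ω) (fun t => a t ω) (fun t => r t ω) t x b)
      atTop (𝓝 (P.optQ x b)) := by
  -- The rates are deterministic, so a single good sample point yields their bounds and square
  -- summability.
  obtain ⟨ω₀, hω₀⟩ := hτ.exists
  obtain ⟨hτ0, hτ1, hτ2⟩ := learningRates_of_visits fun x b => (hω₀ x b).2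
  obtain ⟨R, hR⟩ := P.bounded
  obtain ⟨K, hK⟩ := (Set.finite_range fun z : S × A => |P.meanReward z.1 z.2|).bddAbove
  obtain ⟨K₀, hK₀⟩ := (Set.finite_range fun z : S × A => |Q₀ z.1 z.2|).bddAbove
  obtain ⟨K₁, hK₁⟩ := (Set.finite_range fun z : S × A => |P.optQ z.1 z.2|).bddAbove
  have hγ : 0 < 1 - P.γ := sub_pos.2 P.γ_lt_one
  -- `R + γ * C ≤ C` holds exactly when `C ≥ R / (1 - γ)`; `K₀` accounts for the initial table.
  set C : ℝ := max K₀ (R / (1 - P.γ)) with hC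
  have hRC : R + P.γ * C ≤ C := by
    have : R ≤ C * (1 - P.γ) := (div_le_iff₀ hγ).1 (le_max_right _ _)
    linarith
  have hrR := hrun.ae_abs_reward_le hR
  let Q : Ω → ℕ → S → A → ℝ := fun ω =>
    qLearning P.γ τ Q₀ (fun t => s t ω) (fun t => a t ω) (fun t => r t ω)
  have hQ : ∀ᵐ ω ∂μ, ∀ t x b, |Q ω t x b| ≤ C := by
    filter_upwards [hrR] with ω hω
    exact abs_qLearning_le P.γ_nonneg hτ0 hτ1 hω
      (fun x b => (hK₀ ⟨(x, b), rfl⟩).trans (le_max_left _ _)) hRC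
  let v : ℕ → Ω → S → ℝ := fun t ω x => Finset.univ.sup' Finset.univ_nonempty (Q ω t x)
  have hv : ∀ᵐ ω ∂μ, ∀ t x, |v t ω x| ≤ C := by
    filter_upwards [hQ] with ω hω t x
    exact abs_sup'_le (hω t x)
  have hvmeas : ∀ t x, Measurable[ℱ t] fun ω => v t ω x := fun t x =>
    measurable_sup'_univ fun b => hrun.measurable_qLearning P.γ τ Q₀ t x b
  let w : ℕ → Ω → ℝ := fun t ω => P.targetNoise (v t ω) (s t ω) (a t ω) (r t ω) (s (t + 1) ω)
  let α : ℕ → S × A → Ω → ℝ := fun t z ω => if s t ω = z.1 ∧ a t ω = z.2 then τ t else 0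
  have hαmeas : ∀ t z, Measurable[ℱ t] (α t z) := fun t z =>
    Measurable.ite (hrun.measurableSet_pair t z.1 z.2) measurable_const measurable_const
  have hα0 : ∀ t z ω, 0 ≤ α t z ω := by
    intro t z ω
    simp only [α]
    split_ifs <;> simp [hτ0]
  have hατ : ∀ t z ω, α t z ω ≤ τ t := by
    intro t z ω
    simp only [α]
    split_ifs <;> simp [hτ0]
  have hwmeas : ∀ t, Measurable[ℱ (t + 1)] (w t) := fun t => hrun.measurable_targetNoise (hvmeas t)
  have hwbdd : ∀ᵐ ω ∂μ, ∀ t, |w t ω| ≤ R + K + 2 * (P.γ * C) := by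
    filter_upwards [hrR, hv] with ω h1 h2 t
    exact MDP.abs_targetNoise_le (h1 t) (hK ⟨(s t ω, a t ω), rfl⟩) (h2 t)
  have hdbdd : ∀ z t, ∀ᵐ ω ∂μ, |α t z ω * w t ω| ≤ τ t * (R + K + 2 * (P.γ * C)) := by
    intro z t
    filter_upwards [hwbdd] with ω hω
    rw [abs_mul, abs_of_nonneg (hα0 t z ω)]
    exact mul_le_mul (hατ t z ω) (hω t) (abs_nonneg _) (hτ0 t)
  have hdmeas : ∀ z t, Measurable[ℱ (t + 1)] fun ω => α t z ω * w t ω := fun z t =>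
    ((hαmeas t z).mono (ℱ.mono t.le_succ) le_rfl).mul (hwmeas t)
  have hnoise : ∀ᵐ ω ∂μ, ∀ z, ∃ l,
      Tendsto (fun n => ∑ t ∈ Finset.range n, α t z ω * w t ω) atTop (𝓝 l) := by
    refine ae_all_iff.2 fun z => ?_
    refine ae_exists_tendsto_sum_of_martingale_diff (hdmeas z) (hdbdd z) ?_ fun t => ?_
    · simp_rw [mul_pow]
      exact hτ2.mul_right _
    · have h1 := condExp_mul_of_stronglyMeasurable_left (hαmeas t z).stronglyMeasurable
        (Integrable.of_bound ((hdmeas z t).mono (ℱ.le _) le_rfl).aestronglyMeasurable _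
          (hdbdd z t))
        (Integrable.of_bound ((hwmeas t).mono (ℱ.le _) le_rfl).aestronglyMeasurable _
          (hwbdd.mono fun ω hω => hω t))
      refine h1.trans ?_
      filter_upwards [hrun.condExp_targetNoise (hvmeas t) (hv.mono fun ω hω => hω t)] with ω hω
      rw [Pi.mul_apply, hω]
      simp
  filter_upwards [hτ, hQ, hnoise] with ω h1 h2 h3 x b
  have key := tendsto_zero_of_contraction (Z := S × A) P.γ_nonneg P.γ_lt_one
    (x := fun t z => Q ω t z.1 z.2 - P.optQ z.1 z.2) (α := fun t z => α t z ω)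
    -- The same noise serves all coordinates, since `α t z` vanishes off the visited pair.
    (w := fun t _ => w t ω)
    (h := fun t z => P.γ * (∑ y, P.trans z.1 z.2 y * v t ω y -
      ∑ y, P.trans z.1 z.2 y * P.optValue y)) (C := C + K₁)
    (fun t z => hα0 t z ω) (fun t z => (hατ t z ω).trans (hτ1 t))
    (fun z => tendsto_sum_ite_atTop (h1 z.1 z.2).1 (h1 z.1 z.2).2.sum_eq_top) h3
    (fun t z => qLearning_succ_sub_optQ P τ Q₀ _ _ _ t z.1 z.2)
    (fun t B hB z => ?_) (fun t z => ?_) (x, b)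
  · simpa using key.add_const (P.optQ x b)
  · rw [abs_mul, abs_of_nonneg P.γ_nonneg]
    refine mul_le_mul_of_nonneg_left (P.abs_sum_trans_mul_sub_le _ _ fun y => ?_) P.γ_nonneg
    rw [P.optValue_eq]
    exact abs_sup'_sub_sup'_le fun b' => hB (y, b')
  · exact (abs_sub _ _).trans (add_le_add (h2 t z.1 z.2) (hK₁ ⟨z, rfl⟩))

end AntiJamming

theorem theorem1 {M D E : ℕ}
    (P : AntiJamming.MDP (AntiJamming.State D E) (AntiJamming.Action M))
    {Ω : Type*} [mΩ : MeasurableSpace Ω] (μ : Measure Ω) [IsProbabilityMeasure μ]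
    (ℱ : Filtration ℕ mΩ)
    (s : ℕ → Ω → AntiJamming.State D E) (a : ℕ → Ω → AntiJamming.Action M) (r : ℕ → Ω → ℝ)
    (hrun : AntiJamming.IsRun P μ ℱ s a r)
    (τ : ℕ → ℝ)
    (hτ : ∀ᵐ ω ∂μ, ∀ (x : AntiJamming.State D E) (b : AntiJamming.Action M),
      {t : ℕ | s t ω = x ∧ a t ω = b}.Infinite ∧
      AntiJamming.LearningRateRules fun i =>
        τ (AntiJamming.visitTime (fun t => s t ω) (fun t => a t ω) x b i))
    (Q₀ : AntiJamming.State D E → AntiJamming.Action M → ℝ) :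
    ∀ᵐ ω ∂μ, ∀ (x : AntiJamming.State D E) (b : AntiJamming.Action M),
      Tendsto
        (fun t => AntiJamming.qLearning P.γ τ Q₀
          (fun t => s t ω) (fun t => a t ω) (fun t => r t ω) t x b)
        atTop (𝓝 (P.optQ x b)) := by
  exact hrun.ae_tendsto_qLearning hτ Q₀
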